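/- Let $n\ge 1$, let $T=\{1,\dots,n\}$ be a set of teams and $P=\{p_1,\dots,p_m\}$ a set of participants. An instance consists of a complete and transitive preference (ties allowed) $\succsim_i$ over $P$ for each team $i$ and $\succsim_p$ over $T$ for each participant $p$. Let $k=\lfloor m/n\rfloor$ and $r=m-kn$; team $i$ has slots $i_1,\dots,i_{k+1}$ if $i\le r$ and $i_1,\dots,i_k$ otherwise, and $L$ is the set of all $m$ slots. Fix an arbitrary strict total order on $P\times L$, and for every instance arbitrary real values of the slots for the participants such that each slot ranks the participants as its team does. Consider the following algorithm. Start with eligibility sets $E_j=\emptyset$ $(1\le j\le m)$ and the empty matching $S\subseteq P\times L$. While $S$ leaves a participant or a slot unmatched: for each $p_j$ unmatched in $S$, add to $E_j$ all of $p_j$'s most preferred teams among those not in $E_j$; then replace $S$ by a matching chosen as follows. Among the matchings in which each $p_j$ is unmatched or matched to a slot of a team in $E_j$, maximize lexicographically the slots' values in the order $1_1,2_1,\dots,n_1,1_2,2_2,\dots$ (an unmatched slot has value $-\infty$); among those matchings, optimize lexicographically the outcomes of $p_1,\dots,p_m$ in this order, where $p_j$ compares slots by $\succsim_{p_j}$ applied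 to their teams and being unmatched is worse than any slot; among those matchings, take the lexicographically optimal one with respect to the order on $P\times L$, i.e. of two matchings the better one is the one that contains the first pair on which they differ. When the loop ends, assign each participant to the team of her slot in $S$. Then the algorithm returns exactly one allocation for every instance, and it is group-strategyproof for participants: let $I$ be an instance, $X\subseteq P$ non-empty, and $I'$ an instance obtained from $I$ by replacing the preference of each $p\in X$ with an arbitrary (possibly identical) one. If $A$ and $A'$ are the allocations returned for $I$ and $I'$, then some $p\in X$ is assigned to a weakly better team in $A$ than in $A'$ with respect to her original preference $\succsim_p$. That is, no coalition of participants can misreport preferences so that every member is strictly better off. -/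

import Mathlib

/-- A preference list: a complete and transitive relation, indifferences allowed.
`R.rel a b` reads: `a` is weakly preferred to `b`. -/
structure Preference (α : Type) where
  rel : α → α → Prop
  total : ∀ a b, rel a b ∨ rel b a
  trans : ∀ a b c, rel a b → rel b c → rel a c

/-- An instance with teams `Fin n` and participants `Fin m`. -/
structure MatchingInstance (n m : ℕ) where
  /-- the preference of each team over the participants -/
  teamPref : Fin n → Preference (Fin m)
  /-- the preference of each participant over the teams -/
  partPref : Fin m → Preference (Fin n)

/-- An allocation (an ordered partition of the participants into `n` possibly empty parts),
given by the team to which each participant is assigned. -/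
abbrev Allocation (n m : ℕ) : Type := Fin m → Fin n

/-- With `k = ⌊m / n⌋` and `r = m - k n`, the first `r` teams have `k + 1` slots, the others `k`. -/
def slotCount (n m : ℕ) (i : Fin n) : ℕ :=
  if i.val < m - (m / n) * n then m / n + 1 else m / n

/-- The team-slots: `⟨i, l⟩` is the `l`-th slot of team `i`. -/
abbrev Slot (n m : ℕ) : Type := (i : Fin n) × Fin (slotCount n m i)

/-- Round-robin order on the slots: first slots of all teams, then the second slots, and so on. -/
def roundRobin {n m : ℕ} (x y : Slot n m) : Prop :=
  x.2.val < y.2.val ∨ (x.2.val = y.2.val ∧ x.1 < y.1)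

/-- The slots' values for the participants represent the preferences of the slots' teams. -/
def ConsistentValues {n m : ℕ} (I : MatchingInstance n m) (v : Slot n m → Fin m → ℝ) : Prop :=
  ∀ x p q, v x q ≤ v x p ↔ (I.teamPref x.1).rel p q

/-- Sets of pairs (participant, slot). -/
abbrev PairSet (n m : ℕ) : Type := Finset (Fin m × Slot n m)

/-- A matching: every participant and every slot lies in at most one pair. -/
def IsMatching {n m : ℕ} (S : PairSet n m) : Prop :=
  (∀ p x y, (p, x) ∈ S → (p, y) ∈ S → x = y) ∧ (∀ p q x, (p, x) ∈ S → (q, x) ∈ S → p = q)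

def PartMatched {n m : ℕ} (S : PairSet n m) (p : Fin m) : Prop := ∃ x, (p, x) ∈ S

def SlotMatched {n m : ℕ} (S : PairSet n m) (x : Slot n m) : Prop := ∃ p, (p, x) ∈ S

/-- All participants and all slots are matched. -/
def FullyMatched {n m : ℕ} (S : PairSet n m) : Prop :=
  (∀ p, PartMatched S p) ∧ (∀ x, SlotMatched S x)

/-- The value that a slot receives in a matching: its value for its partner, and `⊥` (i.e. `-∞`)
if it is unmatched. (The supremum ranges over at most one participant.) -/
noncomputable def slotValue {n m : ℕ} (v : Slot n m → Fin m → ℝ) (S : PairSet n m)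
    (x : Slot n m) : WithBot ℝ :=
  (Finset.univ.filter fun p => (p, x) ∈ S).sup fun p => (v x p : WithBot ℝ)

/-- Participant `p` weakly prefers the outcome of `S` to that of `S'`; being unmatched is worse
than being matched to any slot. -/
def PartWeaklyPrefers {n m : ℕ} (I : MatchingInstance n m) (p : Fin m) (S S' : PairSet n m) :
    Prop :=
  ∀ y, (p, y) ∈ S' → ∃ x, (p, x) ∈ S ∧ (I.partPref p).rel x.1 y.1

/-- `S` is lexicographically strictly better than `S'` for the family `ge` of weak comparisons
(`ge i S S'`: `S` is at least as good as `S'` by the `i`-th criterion), where `lt i j` means that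
criterion `i` comes before criterion `j`. -/
def LexBetter {ι μ : Type} (lt : ι → ι → Prop) (ge : ι → μ → μ → Prop) (S S' : μ) : Prop :=
  ∃ i, (ge i S S' ∧ ¬ ge i S' S) ∧ ∀ j, lt j i → ge j S S' ∧ ge j S' S

/-- The members of `C` that are lexicographically optimal within `C`. -/
def lexOptimal {ι μ : Type} (lt : ι → ι → Prop) (ge : ι → μ → μ → Prop) (C : Set μ) : Set μ :=
  {S | S ∈ C ∧ ∀ S' ∈ C, ¬ LexBetter lt ge S' S}

/-- The matchings in which participants are matched only to slots of teams eligible for them. -/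
def eligibleMatchings {n m : ℕ} (E : Fin m → Set (Fin n)) : Set (PairSet n m) :=
  {S | IsMatching S ∧ ∀ p x, (p, x) ∈ S → x.1 ∈ E p}

/-- The matchings that may be chosen for the eligibility sets `E`: among the eligible matchings,
optimize the slots' values in round-robin order; among the optima, optimize the participants'
preferences in the order of their indices; among the optima, optimize lexicographically with
respect to the order `prec` on the pairs, where containing a pair is better than not doing so. -/
def chosenMatchings {n m : ℕ} (I : MatchingInstance n m) (v : Slot n m → Fin m → ℝ)
    (prec : Fin m × Slot n m → Fin m × Slot n m → Prop) (E : Fin m → Set (Fin n)) :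
    Set (PairSet n m) :=
  lexOptimal prec (fun e S S' => e ∈ S' → e ∈ S) <|
    lexOptimal (fun p q : Fin m => p < q) (fun p S S' => PartWeaklyPrefers I p S S') <|
      lexOptimal roundRobin (fun x S S' => slotValue v S' x ≤ slotValue v S x) <|
        eligibleMatchings E

/-- Every participant unmatched in `S` adds to her eligibility set all of her most preferred teams
among those not yet in it. -/
def expandEligibility {n m : ℕ} (I : MatchingInstance n m) (E : Fin m → Set (Fin n))
    (S : PairSet n m) (p : Fin m) : Set (Fin n) :=
  E p ∪ {i | ¬ PartMatched S p ∧ i ∉ E p ∧ ∀ j, j ∉ E p → (I.partPref p).rel i j}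

/-- `Reached I v prec E S`: at some evaluation of the guard of the while-loop, the eligibility sets
are `E` and the current matching is `S`. -/
inductive Reached {n m : ℕ} (I : MatchingInstance n m) (v : Slot n m → Fin m → ℝ)
    (prec : Fin m × Slot n m → Fin m × Slot n m → Prop) :
    (Fin m → Set (Fin n)) → PairSet n m → Prop
  | init : Reached I v prec (fun _ => ∅) ∅
  | step (E : Fin m → Set (Fin n)) (S S' : PairSet n m) :
      Reached I v prec E S → ¬ FullyMatched S →
      S' ∈ chosenMatchings I v prec (expandEligibility I E S) →
      Reached I v prec (expandEligibility I E S) S'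

/-- The algorithm terminates on `I` and returns `A`. -/
def Returns {n m : ℕ} (I : MatchingInstance n m) (v : Slot n m → Fin m → ℝ)
    (prec : Fin m × Slot n m → Fin m × Slot n m → Prop) (A : Allocation n m) : Prop :=
  ∃ E S, Reached I v prec E S ∧ FullyMatched S ∧ ∀ p x, (p, x) ∈ S → A p = x.1

/-- An algorithm, given by the allocation it returns for each instance, is group-strategyproof for
participants: if the participants in a non-empty set `X` replace their preference lists, some
`p ∈ X` is assigned to a weakly better team without the misreports, by her original preference. -/
def GroupStrategyproof {n m : ℕ} (alg : MatchingInstance n m → Allocation n m) : Prop :=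
  ∀ (I I' : MatchingInstance n m) (X : Set (Fin m)), X.Nonempty →
    I'.teamPref = I.teamPref → (∀ p, p ∉ X → I'.partPref p = I.partPref p) →
    ∃ p ∈ X, (I.partPref p).rel (alg I p) (alg I' p)

/-!
The three successive lexicographic criteria of the algorithm are additive over the pairs of a
matching, so they are represented by a single weight `W` with natural values: the matching chosen
for the eligibility sets `E` is the unique eligible matching of largest weight
(`exists_choiceWeight`). Counting slots shows that there are as many as participants
(`card_slot`), and as long as the matching is not full, an unmatched participant can still extend
her eligibility set, so the loop ends, and its result is determined (`exists_fullyMatched`,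
`returns_iff`).

As the matchings have largest weight, they are supported by prices `π` of the slots and utilities
`u` of the participants (`exists_isDual`, from Egerváry's theorem `exists_tight_equiv`). Since the
maximizer is unique with a gap, the prices can strictly exclude all unmatched participants. Only
unmatched participants expand, hence prices can be taken to rise in the course of the run
(`IsDual.sup`): a participant once priced out of a team remains so. This gives the loop invariant
`Invariant`: participants are matched only within the indifference class added last, and the
current prices strictly exclude every rejected pair. A consequence is that the second criterion
matters only through the wish to be matched, so that the weight can be taken from the instance in
which all participants are indifferent (`invariant_eligibilityAt`). Then truthful and misreported
instances share one weight.

Let all members of a coalition `X` prefer their teams in the matching `S'`, with final prices `π'`,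
that results from misreports. Consider the last round `t` of the truthful run at which some
`p ∈ X` is unmatched with the team of `S' p` already in her eligibility set, and the prices `π` of
this round. If `π' x < π x`, then `x` is matched in round `t`, to `q` say. Either `q` has been
rejected by the team of `S' q` before, so that `S' q` now costs more than what `q` could bear, or
`q` truthfully ranks `x` and `S' q` equally and has become better off under `π'` at `x`, hence
at `S' q`; in both cases `π' (S' q) < π (S' q)`. So `x ↦ S' q` is an injection of the finite set of
dearer slots into itself, hence onto. But `S' p` is in this set and `p` is unmatched in round `t`,
a contradiction (`exists_rel_of_misreport`).
-/

/-! ### Egerváry's theorem -/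

open Finset in
/-- **Egerváry's theorem** for a square matrix of natural numbers: some potentials `u`, `v`
dominate the matrix, with equality along a bijection. A feasible integral pair of least total is
tight along a bijection, since a violation of Hall's condition by the graph of tight entries lets
one lower the total. -/
theorem exists_tight_equiv {α β : Type*} [Fintype α] [Fintype β] [DecidableEq α] [DecidableEq β]
    (hcard : Fintype.card α = Fintype.card β) (w : α → β → ℕ) :
    ∃ (u : α → ℕ) (v : β → ℕ) (σ : α ≃ β),
      (∀ a b, w a b ≤ u a + v b) ∧ ∀ a, w a (σ a) = u a + v (σ a) := by
  have key : ∀ (k : ℕ) (u : α → ℤ) (v : β → ℤ), (∀ a b, (w a b : ℤ) ≤ u a + v b) →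
      ∑ a, u a + ∑ b, v b < k → ∃ (u : α → ℤ) (v : β → ℤ) (σ : α ≃ β),
      (∀ a b, (w a b : ℤ) ≤ u a + v b) ∧ ∀ a, (w a (σ a) : ℤ) = u a + v (σ a) := by
    intro k
    induction k with
    | zero =>
      intro u v huv hlt
      exfalso
      obtain ⟨e⟩ := Fintype.card_eq.mp hcard
      have h1 : ∑ b, v b = ∑ a, v (e a) := (Equiv.sum_comp e v).symm
      have h2 : 0 ≤ ∑ a, (u a + v (e a)) :=
        Finset.sum_nonneg fun a _ => le_trans (Int.natCast_nonneg _) (huv a (e a))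
      rw [Finset.sum_add_distrib, ← h1] at h2
      push_cast at hlt
      omega
    | succ k ih =>
      intro u v huv hlt
      let t : α → Finset β := fun a => univ.filter fun b => (w a b : ℤ) = u a + v b
      by_cases hall : ∀ s : Finset α, #s ≤ #(s.biUnion t)
      · obtain ⟨f, hf, hft⟩ := (Finset.all_card_le_biUnion_card_iff_exists_injective t).mp hall
        have hbij : Function.Bijective f :=
          (Fintype.bijective_iff_injective_and_card f).mpr ⟨hf, hcard⟩
        refine ⟨u, v, Equiv.ofBijective f hbij, huv, fun a => ?_⟩
        simpa [t] using hft a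
      · push Not at hall
        obtain ⟨s, hs⟩ := hall
        apply ih (fun a => u a - if a ∈ s then 1 else 0)
          (fun b => v b + if b ∈ s.biUnion t then 1 else 0)
        · intro a b
          have hab := huv a b
          by_cases ha : a ∈ s
          · by_cases hb : b ∈ s.biUnion t
            · simp only [ha, hb, if_true]; omega
            · have hne : (w a b : ℤ) ≠ u a + v b := fun h =>
                hb (mem_biUnion.mpr ⟨a, ha, by simpa [t] using h⟩)
              simp only [ha, hb, if_true, if_false]; omega
          · simp only [ha, if_false]; split_ifs <;> omega
        · rw [Finset.sum_sub_distrib, Finset.sum_add_distrib, Finset.sum_boole, Finset.sum_boole]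
          simp only [filter_mem_eq_inter, univ_inter]
          push_cast at hlt
          omega
  obtain ⟨u, v, σ, huv, hσ⟩ := key
    ((∑ a : α, ((∑ b, w a b : ℕ) : ℤ) + ∑ _b : β, (0 : ℤ)).toNat + 1)
    (fun a => ((∑ b, w a b : ℕ) : ℤ)) (fun _ => 0)
    (fun a b => by
      rw [add_zero]
      exact_mod_cast Finset.single_le_sum (f := fun b => w a b) (fun _ _ => Nat.zero_le _)
        (mem_univ b))
    (by omega)
  rcases isEmpty_or_nonempty β with hβ | hβ
  · have hα : IsEmpty α := by
      rw [← Fintype.card_eq_zero_iff, hcard]; exact Fintype.card_eq_zero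
    exact ⟨fun _ => 0, fun _ => 0, σ, fun a => hα.elim a, fun a => hα.elim a⟩
  · -- shifting the potentials against each other makes the least `v` equal to zero
    obtain ⟨b₀, hb₀⟩ := Finite.exists_min v
    have hu : ∀ a, 0 ≤ u a + v b₀ := fun a => le_trans (Int.natCast_nonneg _) (huv a b₀)
    refine ⟨fun a => (u a + v b₀).toNat, fun b => (v b - v b₀).toNat, σ, fun a b => ?_,
      fun a => ?_⟩
    · have := huv a b; have := hu a; have := hb₀ b; dsimp only; omega
    · have := hσ a; have := hu a; have := hb₀ (σ a); dsimp only; omega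

/-- There are as many slots as participants. -/
theorem card_slot {n m : ℕ} (hn : 0 < n) : Fintype.card (Slot n m) = m := by
  have hr : m - m / n * n = m % n := by
    have := Nat.div_add_mod' m n; omega
  have h1 : ∀ i : Fin n, slotCount n m i = m / n + if i.val < m % n then 1 else 0 := by
    intro i
    unfold slotCount
    rw [hr]
    split_ifs <;> rfl
  have h2 : (∑ i : Fin n, if i.val < m % n then 1 else 0) = m % n := by
    rw [Fin.sum_univ_eq_sum_range (fun i => if i < m % n then 1 else 0) n, Finset.sum_boole]
    have : (Finset.range n).filter (fun i => i < m % n) = Finset.range (m % n) := by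
      ext i
      have := Nat.mod_lt m hn
      simp only [Finset.mem_filter, Finset.mem_range]
      omega
    rw [this]; simp
  rw [Fintype.card_sigma]
  simp only [Fintype.card_fin, h1, Finset.sum_add_distrib, h2]
  simp only [Finset.sum_const, Finset.card_univ, Fintype.card_fin, smul_eq_mul]
  have := Nat.div_add_mod m n
  omega

/-! ### Optimal dual solutions -/

/-- The total weight of the pairs of `S`. -/
def weight {n m : ℕ} (W : Fin m × Slot n m → ℕ) (S : PairSet n m) : ℕ := ∑ e ∈ S, W e

/-- `u` and `π` are an optimal dual solution that certifies that the matching `S` has the largest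
weight among the matchings that respect the eligibility sets `E`: a utility of each participant and
a price of each slot which cover the weight of every eligible pair, exactly so on `S`, and vanish
off `S`. -/
structure IsDual {n m : ℕ} (W : Fin m × Slot n m → ℕ) (E : Fin m → Set (Fin n)) (S : PairSet n m)
    (u : Fin m → ℕ) (π : Slot n m → ℕ) : Prop where
  cover : ∀ p x, x.1 ∈ E p → W (p, x) ≤ u p + π x
  tight : ∀ p x, (p, x) ∈ S → W (p, x) = u p + π x
  part : ∀ p, ¬ PartMatched S p → u p = 0
  slot : ∀ x, ¬ SlotMatched S x → π x = 0

section Dual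

variable {n m : ℕ} {W : Fin m × Slot n m → ℕ} {E : Fin m → Set (Fin n)} {S : PairSet n m}

theorem sum_fst_add_sum_compl (hS : IsMatching S) (u : Fin m → ℕ) :
    ∑ e ∈ S, u e.1 + ∑ p ∈ (S.image Prod.fst)ᶜ, u p = ∑ p, u p := by
  rw [← Finset.sum_add_sum_compl (S.image Prod.fst) u, Finset.sum_image]
  rintro ⟨p, x⟩ hx ⟨q, y⟩ hy rfl
  rw [hS.1 p x y hx hy]

theorem sum_snd_add_sum_compl (hS : IsMatching S) (π : Slot n m → ℕ) :
    ∑ e ∈ S, π e.2 + ∑ x ∈ (S.image Prod.snd)ᶜ, π x = ∑ x, π x := by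
  rw [← Finset.sum_add_sum_compl (S.image Prod.snd) π, Finset.sum_image]
  rintro ⟨p, x⟩ hx ⟨q, y⟩ hy (rfl : x = y)
  rw [hS.2 p q x hx hy]

/-- Complementary slackness: a feasible dual solution whose objective does not exceed the weight of
`S` is tight on `S` and vanishes off it. -/
theorem isDual_of_sum_le (hS : S ∈ eligibleMatchings E) {u : Fin m → ℕ} {π : Slot n m → ℕ}
    (hcov : ∀ p x, x.1 ∈ E p → W (p, x) ≤ u p + π x)
    (hsum : ∑ p, u p + ∑ x, π x ≤ weight W S) : IsDual W E S u π := by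
  have hle : ∀ e ∈ S, W e ≤ u e.1 + π e.2 := fun e he => hcov e.1 e.2 (hS.2 e.1 e.2 he)
  have h1 := Finset.sum_le_sum hle
  have h2 := sum_fst_add_sum_compl hS.1 u
  have h3 := sum_snd_add_sum_compl hS.1 π
  rw [Finset.sum_add_distrib] at h1
  unfold weight at hsum
  have hu : ∑ p ∈ (S.image Prod.fst)ᶜ, u p = 0 := by omega
  have hπ : ∑ x ∈ (S.image Prod.snd)ᶜ, π x = 0 := by omega
  have heq : ∑ e ∈ S, W e = ∑ e ∈ S, (u e.1 + π e.2) := by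
    rw [Finset.sum_add_distrib]; omega
  rw [Finset.sum_eq_sum_iff_of_le hle] at heq
  rw [Finset.sum_eq_zero_iff] at hu hπ
  refine ⟨hcov, fun p x h => heq _ h, fun p hp => hu p ?_, fun x hx => hπ x ?_⟩
  · simpa [PartMatched] using hp
  · simpa [SlotMatched] using hx

theorem IsDual.sum_eq {u : Fin m → ℕ} {π : Slot n m → ℕ} (h : IsDual W E S u π)
    (hS : IsMatching S) : ∑ p, u p + ∑ x, π x = weight W S := by
  have hu : ∑ p ∈ (S.image Prod.fst)ᶜ, u p = 0 :=
    Finset.sum_eq_zero fun p hp => h.part p (by simpa [PartMatched] using hp)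
  have hπ : ∑ x ∈ (S.image Prod.snd)ᶜ, π x = 0 :=
    Finset.sum_eq_zero fun x hx => h.slot x (by simpa [SlotMatched] using hx)
  rw [← sum_fst_add_sum_compl hS u, ← sum_snd_add_sum_compl hS π, hu, hπ, add_zero, add_zero,
    ← Finset.sum_add_distrib]
  exact Finset.sum_congr rfl fun e he => (h.tight e.1 e.2 he).symm

/-- Every eligible matching of largest weight has an optimal dual solution. -/
theorem exists_isDual (hn : 0 < n) (hS : S ∈ eligibleMatchings E)
    (hmax : ∀ S' ∈ eligibleMatchings E, weight W S' ≤ weight W S) : ∃ u π, IsDual W E S u π := by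
  classical
  obtain ⟨u, π, σ, hcov, hσ⟩ := exists_tight_equiv
    (by rw [card_slot hn, Fintype.card_fin] : Fintype.card (Fin m) = Fintype.card (Slot n m))
    (fun p x => if x.1 ∈ E p then W (p, x) else 0)
  refine ⟨u, π, isDual_of_sum_le hS (fun p x hx => by simpa [hx] using hcov p x) ?_⟩
  let A : Finset (Fin m) := Finset.univ.filter fun p => (σ p).1 ∈ E p
  have hinj : Set.InjOn (fun p => (p, σ p)) (A : Set (Fin m)) := fun p _ q _ h =>
    congrArg Prod.fst h
  have hmem : ∀ p x, (p, x) ∈ A.image (fun p => (p, σ p)) ↔ (σ p).1 ∈ E p ∧ σ p = x := by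
    intro p x
    simp only [A, Finset.mem_image, Finset.mem_filter, Finset.mem_univ, true_and, Prod.mk.injEq]
    constructor
    · rintro ⟨q, h, rfl, rfl⟩; exact ⟨h, rfl⟩
    · rintro ⟨h, rfl⟩; exact ⟨p, h, rfl, rfl⟩
  have hel : A.image (fun p => (p, σ p)) ∈ eligibleMatchings E := by
    refine ⟨⟨fun p x y hx hy => ?_, fun p q x hp hq => ?_⟩, fun p x hx => ?_⟩
    · rw [← ((hmem _ _).mp hx).2, ((hmem _ _).mp hy).2]
    · exact σ.injective (((hmem _ _).mp hp).2.trans ((hmem _ _).mp hq).2.symm)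
    · obtain ⟨h, rfl⟩ := (hmem _ _).mp hx; exact h
  refine le_trans (le_of_eq ?_) (hmax _ hel)
  rw [weight, Finset.sum_image hinj, Finset.sum_filter, ← Equiv.sum_comp σ π,
    ← Finset.sum_add_distrib]
  exact Finset.sum_congr rfl fun p _ => (hσ p).symm

end Dual

/-! ### Lexicographic optimization as maximization of a weight -/

section Lexicographic

variable {ι μ : Type} {lt : ι → ι → Prop}

theorem lexOptimal_congr {ge ge' : ι → μ → μ → Prop} {C : Set μ}
    (h : ∀ i, ∀ S ∈ C, ∀ S' ∈ C, ge i S S' ↔ ge' i S S') :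
    lexOptimal lt ge C = lexOptimal lt ge' C := by
  ext S
  refine and_congr_right fun hS => forall₂_congr fun S' hS' => not_congr ?_
  simp only [LexBetter, h _ S hS S' hS', h _ S' hS' S hS]

/-- Two objects with different scores differ first in some criterion, so one of them is
lexicographically better. -/
theorem lexBetter_trichotomy [Finite ι] [IsStrictTotalOrder ι lt] (c : ι → μ → ℕ) (S S' : μ) :
    (∀ i, c i S = c i S') ∨ LexBetter lt (fun i S S' => c i S' ≤ c i S) S S' ∨
      LexBetter lt (fun i S S' => c i S' ≤ c i S) S' S := by
  by_cases h : ∀ i, c i S = c i S'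
  · exact Or.inl h
  right
  push Not at h
  have wf : WellFounded lt := Finite.wellFounded_of_trans_of_irrefl lt
  obtain ⟨i, hi, hmin⟩ := wf.has_min {i | c i S ≠ c i S'} h
  have heq : ∀ j, lt j i → c j S = c j S' := fun j hj => by
    by_contra hne; exact hmin j hne hj
  rcases lt_or_gt_of_ne hi with hlt | hlt
  · exact Or.inr ⟨i, ⟨hlt.le, not_le.mpr hlt⟩, fun j hj => ⟨(heq j hj).le, (heq j hj).ge⟩⟩
  · exact Or.inl ⟨i, ⟨hlt.le, not_le.mpr hlt⟩, fun j hj => ⟨(heq j hj).ge, (heq j hj).le⟩⟩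

/-- Lexicographic comparison of finitely many additive criteria amounts to comparison of a single
additive weight: each further, less important criterion `c` is appended by passing from `W` to
`K * W + c` with `K` above all values of `c`. -/
theorem exists_lexWeight {ε : Type} [Fintype ε] [Fintype ι] [IsStrictTotalOrder ι lt]
    (c : ι → ε → ℕ) : ∃ W : ε → ℕ, ∀ S S' : Finset ε,
      LexBetter lt (fun i S S' => ∑ e ∈ S', c i e ≤ ∑ e ∈ S, c i e) S S' ↔
        ∑ e ∈ S', W e < ∑ e ∈ S, W e := by
  classical
  let _ : LinearOrder ι := linearOrderOfSTO lt
  have key : ∀ s : Finset ι, ∃ W : ε → ℕ,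
      (∀ S S' : Finset ε, (∀ j ∈ s, ∑ e ∈ S, c j e = ∑ e ∈ S', c j e) →
        ∑ e ∈ S, W e = ∑ e ∈ S', W e) ∧
      ∀ S S' : Finset ε, ∀ i ∈ s, ∑ e ∈ S', c i e < ∑ e ∈ S, c i e →
        (∀ j ∈ s, j < i → ∑ e ∈ S, c j e = ∑ e ∈ S', c j e) →
        ∑ e ∈ S', W e < ∑ e ∈ S, W e := by
    intro s
    induction s using Finset.induction_on_max with
    | empty => exact ⟨fun _ => 0, by simp, by simp⟩
    | insert a s hmax ih =>
      obtain ⟨W, heq, hlt⟩ := ih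
      have hbound : ∀ S : Finset ε, ∑ e ∈ S, c a e < ∑ e, c a e + 1 := fun S =>
        Nat.lt_succ_of_le (Finset.sum_le_univ_sum_of_nonneg fun _ => Nat.zero_le _)
      generalize ∑ e, c a e + 1 = K at hbound
      refine ⟨fun e => K * W e + c a e, fun S S' h => ?_, fun S S' i hi hc hj => ?_⟩
      · rw [Finset.sum_add_distrib, Finset.sum_add_distrib, ← Finset.mul_sum, ← Finset.mul_sum,
          heq S S' fun j hj => h j (Finset.mem_insert_of_mem hj), h a (Finset.mem_insert_self a s)]
      · rw [Finset.sum_add_distrib, Finset.sum_add_distrib, ← Finset.mul_sum, ← Finset.mul_sum]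
        rcases Finset.mem_insert.mp hi with rfl | hi
        · rw [heq S S' fun j hjs => hj j (Finset.mem_insert_of_mem hjs) (hmax j hjs)]
          omega
        · have h1 := hlt S S' i hi hc fun j hjs => hj j (Finset.mem_insert_of_mem hjs)
          have h2 := Nat.mul_le_mul_left K (Nat.succ_le_of_lt h1)
          have h3 := hbound S'
          rw [Nat.mul_succ] at h2
          omega
  obtain ⟨W, heq, hlt⟩ := key Finset.univ
  have hW : ∀ S S' : Finset ε,
      LexBetter lt (fun i S S' => ∑ e ∈ S', c i e ≤ ∑ e ∈ S, c i e) S S' →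
        ∑ e ∈ S', W e < ∑ e ∈ S, W e := by
    rintro S S' ⟨i, ⟨_, hi⟩, hj⟩
    exact hlt S S' i (Finset.mem_univ i) (not_le.mp hi)
      fun j _ hji => le_antisymm (hj j hji).2 (hj j hji).1
  refine ⟨W, fun S S' => ⟨hW S S', fun h => ?_⟩⟩
  rcases lexBetter_trichotomy (lt := lt) (fun i S => ∑ e ∈ S, c i e) S S' with h1 | h1 | h1
  · have := heq S S' fun j _ => h1 j
    omega
  · exact h1
  · have := hW S' S h1
    omega

/-- The members of `C` at which `f` is largest. -/
def argmaxOn (f : μ → ℕ) (C : Set μ) : Set μ := {S | S ∈ C ∧ ∀ S' ∈ C, f S' ≤ f S}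

theorem argmaxOn_argmaxOn {f g : μ → ℕ} {K : ℕ} (hg : ∀ S, g S < K) (C : Set μ) :
    argmaxOn g (argmaxOn f C) = argmaxOn (fun S => K * f S + g S) C := by
  ext S
  constructor
  · rintro ⟨⟨hS, hf⟩, hmax⟩
    refine ⟨hS, fun S' hS' => ?_⟩
    rcases (hf S' hS').eq_or_lt with h | h
    · have := hmax S' ⟨hS', fun T hT => h ▸ hf T hT⟩
      simp only [h]; omega
    · have h2 := Nat.mul_le_mul_left K (Nat.succ_le_of_lt h)
      have := hg S'
      rw [Nat.mul_succ] at h2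
      show K * f S' + g S' ≤ K * f S + g S
      omega
  · rintro ⟨hS, hmax⟩
    have hf : ∀ S' ∈ C, f S' ≤ f S := by
      intro S' hS'
      by_contra! h
      have h1 : K * f S' + g S' ≤ K * f S + g S := hmax S' hS'
      have h2 := Nat.mul_le_mul_left K (Nat.succ_le_of_lt h)
      have := hg S
      rw [Nat.mul_succ] at h2
      omega
    refine ⟨⟨hS, hf⟩, fun S' hS' => ?_⟩
    have h1 : K * f S' + g S' ≤ K * f S + g S := hmax S' hS'.1
    rw [le_antisymm (hf S' hS'.1) (hS'.2 S hS)] at h1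
    omega

theorem lexOptimal_eq_argmaxOn {ge : ι → μ → μ → Prop} {f : μ → ℕ}
    (h : ∀ S S', LexBetter lt ge S S' ↔ f S' < f S) (C : Set μ) :
    lexOptimal lt ge C = argmaxOn f C := by
  ext S
  simp only [lexOptimal, argmaxOn, Set.mem_ofPred_eq, h, not_lt]

end Lexicographic

/-! ### The weight that represents the choice of matchings -/

open Classical in
/-- The number of alternatives that are strictly worse than `a`. -/
noncomputable def Preference.rank {α : Type} [Fintype α] (R : Preference α) (a : α) : ℕ :=
  (Finset.univ.filter fun b => ¬ R.rel b a).card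

theorem Preference.rank_le_rank {α : Type} [Fintype α] (R : Preference α) (a b : α) :
    R.rank b ≤ R.rank a ↔ R.rel a b := by
  classical
  constructor
  · intro h
    by_contra hab
    refine absurd h (not_le.mpr (Finset.card_lt_card ?_))
    have hba : R.rel b a := (R.total a b).resolve_left hab
    rw [Finset.ssubset_iff_of_subset]
    · exact ⟨a, by simpa using hab, by simpa using R.total a a⟩
    · intro c hc
      simp only [Finset.mem_filter, Finset.mem_univ, true_and] at hc ⊢
      exact fun hcb => hc (R.trans _ _ _ hcb hba)
  · intro hab
    refine Finset.card_le_card fun c hc => ?_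
    simp only [Finset.mem_filter, Finset.mem_univ, true_and] at hc ⊢
    exact fun hca => hc (R.trans _ _ _ hca hab)

section Choice

variable {n m : ℕ}

theorem sum_slotScore {S : PairSet n m} (hS : IsMatching S) {p : Fin m} {x : Slot n m}
    (hp : (p, x) ∈ S) (r : Fin m → ℕ) :
    (∑ e ∈ S, if e.2 = x then r e.1 else 0) = r p := by
  rw [Finset.sum_eq_single (p, x)]
  · simp
  · rintro ⟨q, y⟩ hq hne
    refine if_neg fun h => hne ?_
    obtain rfl : y = x := h
    rw [hS.2 q p y hq hp]
  · exact fun h => absurd hp h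

theorem sum_slotScore_of_not {S : PairSet n m} {x : Slot n m} (hx : ¬ SlotMatched S x)
    (r : Fin m → ℕ) : (∑ e ∈ S, if e.2 = x then r e.1 else 0) = 0 :=
  Finset.sum_eq_zero fun e he => if_neg fun h => hx ⟨e.1, by subst h; exact he⟩

theorem sum_partScore {S : PairSet n m} (hS : IsMatching S) {p : Fin m} {x : Slot n m}
    (hp : (p, x) ∈ S) (r : Slot n m → ℕ) :
    (∑ e ∈ S, if e.1 = p then r e.2 else 0) = r x := by
  rw [Finset.sum_eq_single (p, x)]
  · simp
  · rintro ⟨q, y⟩ hq hne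
    refine if_neg fun h => hne ?_
    obtain rfl : q = p := h
    rw [hS.1 q y x hq hp]
  · exact fun h => absurd hp h

theorem sum_partScore_of_not {S : PairSet n m} {p : Fin m} (hp : ¬ PartMatched S p)
    (r : Slot n m → ℕ) : (∑ e ∈ S, if e.1 = p then r e.2 else 0) = 0 :=
  Finset.sum_eq_zero fun e he => if_neg fun h => hp ⟨e.2, by subst h; exact he⟩

theorem slotValue_of_mem (v : Slot n m → Fin m → ℝ) {S : PairSet n m} (hS : IsMatching S)
    {p : Fin m} {x : Slot n m} (hp : (p, x) ∈ S) : slotValue v S x = (v x p : WithBot ℝ) := by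
  have : (Finset.univ.filter fun q => (q, x) ∈ S) = {p} := by
    ext q
    simp only [Finset.mem_filter, Finset.mem_univ, true_and, Finset.mem_singleton]
    exact ⟨fun hq => hS.2 q p x hq hp, fun h => h ▸ hp⟩
  rw [slotValue, this, Finset.sup_singleton]

theorem slotValue_of_not (v : Slot n m → Fin m → ℝ) {S : PairSet n m}
    {x : Slot n m} (hx : ¬ SlotMatched S x) : slotValue v S x = ⊥ := by
  have : (Finset.univ.filter fun q => (q, x) ∈ S) = ∅ := by
    ext q
    simp only [Finset.mem_filter, Finset.mem_univ, true_and, Finset.notMem_empty, iff_false]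
    exact fun hq => hx ⟨q, hq⟩
  rw [slotValue, this, Finset.sup_empty]

theorem slotValue_le_iff {I : MatchingInstance n m} {v : Slot n m → Fin m → ℝ}
    (hv : ConsistentValues I v) {S S' : PairSet n m} (hS : IsMatching S) (hS' : IsMatching S')
    (x : Slot n m) : slotValue v S' x ≤ slotValue v S x ↔
      (∑ e ∈ S', if e.2 = x then (I.teamPref x.1).rank e.1 + 1 else 0) ≤
        ∑ e ∈ S, if e.2 = x then (I.teamPref x.1).rank e.1 + 1 else 0 := by
  by_cases h' : SlotMatched S' x
  · obtain ⟨q, hq⟩ := h'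
    rw [slotValue_of_mem v hS' hq, sum_slotScore hS' hq fun p => (I.teamPref x.1).rank p + 1]
    by_cases h : SlotMatched S x
    · obtain ⟨p, hp⟩ := h
      rw [slotValue_of_mem v hS hp, sum_slotScore hS hp fun p => (I.teamPref x.1).rank p + 1,
        WithBot.coe_le_coe, hv, Nat.add_le_add_iff_right, Preference.rank_le_rank]
    · rw [slotValue_of_not v h, sum_slotScore_of_not h fun p => (I.teamPref x.1).rank p + 1]
      simp
  · rw [slotValue_of_not v h', sum_slotScore_of_not h' fun p => (I.teamPref x.1).rank p + 1]
    simp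

theorem partWeaklyPrefers_iff (I : MatchingInstance n m) {S S' : PairSet n m}
    (hS : IsMatching S) (hS' : IsMatching S') (p : Fin m) : PartWeaklyPrefers I p S S' ↔
      (∑ e ∈ S', if e.1 = p then (I.partPref p).rank e.2.1 + 1 else 0) ≤
        ∑ e ∈ S, if e.1 = p then (I.partPref p).rank e.2.1 + 1 else 0 := by
  by_cases h' : PartMatched S' p
  · obtain ⟨y, hy⟩ := h'
    rw [sum_partScore hS' hy fun x => (I.partPref p).rank x.1 + 1]
    by_cases h : PartMatched S p
    · obtain ⟨x, hx⟩ := h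
      rw [sum_partScore hS hx fun x => (I.partPref p).rank x.1 + 1, Nat.add_le_add_iff_right,
        Preference.rank_le_rank]
      constructor
      · intro H
        obtain ⟨x', hx', hr⟩ := H y hy
        rwa [hS.1 p x x' hx hx']
      · intro H y' hy'
        exact ⟨x, hx, hS'.1 p y y' hy hy' ▸ H⟩
    · rw [sum_partScore_of_not h fun x => (I.partPref p).rank x.1 + 1]
      refine ⟨fun H => ?_, fun H => absurd H (by omega)⟩
      obtain ⟨x, hx, -⟩ := H y hy
      exact absurd ⟨x, hx⟩ h
  · rw [sum_partScore_of_not h' fun x => (I.partPref p).rank x.1 + 1]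
    exact ⟨fun _ => Nat.zero_le _, fun _ y hy => absurd ⟨y, hy⟩ h'⟩

theorem sum_pairScore (S : PairSet n m) (e : Fin m × Slot n m) :
    (∑ e' ∈ S, if e' = e then 1 else 0) = if e ∈ S then 1 else 0 := by
  rw [Finset.sum_ite_eq']

theorem pairContainment_iff (S S' : PairSet n m) (e : Fin m × Slot n m) :
    (e ∈ S' → e ∈ S) ↔
      (∑ e' ∈ S', if e' = e then 1 else 0) ≤ ∑ e' ∈ S, if e' = e then 1 else 0 := by
  rw [sum_pairScore, sum_pairScore]
  split_ifs <;> simp_all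

instance roundRobin_isStrictTotalOrder : IsStrictTotalOrder (Slot n m) roundRobin where
  irrefl x h := by rcases h with h | ⟨_, h⟩ <;> exact lt_irrefl _ h
  trans x y z hxy hyz := by
    unfold roundRobin at *
    rcases hxy with h | ⟨h, h'⟩ <;> rcases hyz with k | ⟨k, k'⟩
    · left; omega
    · left; omega
    · left; omega
    · right; exact ⟨by omega, h'.trans k'⟩
  trichotomous x y := by
    intro hxy hyx
    obtain ⟨i, a⟩ := x
    obtain ⟨j, b⟩ := y
    simp only [roundRobin, not_or, not_and, not_lt] at hxy hyx
    have h : a.val = b.val := by omega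
    obtain rfl : i = j := le_antisymm (hyx.2 h.symm) (hxy.2 h)
    rw [Fin.ext h]

/-- `S` is the only eligible matching of largest weight, and its weight exceeds that of every other
eligible matching by more than `m`. The gap leaves room for raising the weight of each pair by
one. -/
def IsBest (W : Fin m × Slot n m → ℕ) (E : Fin m → Set (Fin n)) (S : PairSet n m) : Prop :=
  S ∈ eligibleMatchings E ∧ ∀ S' ∈ eligibleMatchings E, S' ≠ S → weight W S' + m < weight W S

theorem IsBest.unique {W : Fin m × Slot n m → ℕ} {E : Fin m → Set (Fin n)} {S S' : PairSet n m}
    (h : IsBest W E S) (h' : IsBest W E S') : S = S' := by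
  by_contra hne
  have h1 := h.2 S' h'.1 (Ne.symm hne)
  have h2 := h'.2 S h.1 hne
  omega

theorem empty_mem_eligibleMatchings (E : Fin m → Set (Fin n)) : ∅ ∈ eligibleMatchings (m := m) E :=
  ⟨⟨by simp, by simp⟩, by simp⟩

/-- A weight of which the matchings chosen by the algorithm are the unique maximizers, whatever the
eligibility sets; it depends on the slots' values only through the teams' preferences. -/
theorem exists_choiceWeight (prec : Fin m × Slot n m → Fin m × Slot n m → Prop)
    [IsStrictTotalOrder (Fin m × Slot n m) prec] (I : MatchingInstance n m) :
    ∃ W : Fin m × Slot n m → ℕ, (∀ E, ∃ S, IsBest W E S) ∧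
      ∀ v, ConsistentValues I v → ∀ E S, S ∈ chosenMatchings I v prec E ↔ IsBest W E S := by
  classical
  obtain ⟨W₁, h₁⟩ := exists_lexWeight (lt := roundRobin) fun (x : Slot n m)
    (e : Fin m × Slot n m) => if e.2 = x then (I.teamPref x.1).rank e.1 + 1 else 0
  obtain ⟨W₂, h₂⟩ := exists_lexWeight (lt := fun p q : Fin m => p < q) fun (p : Fin m)
    (e : Fin m × Slot n m) => if e.1 = p then (I.partPref p).rank e.2.1 + 1 else 0
  obtain ⟨W₃, h₃⟩ := exists_lexWeight (lt := prec) fun (e : Fin m × Slot n m) e' =>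
    if e' = e then 1 else 0
  have hbound : ∀ (W : Fin m × Slot n m → ℕ) (S : PairSet n m), weight W S < ∑ e, W e + 1 :=
    fun W S => Nat.lt_succ_of_le (Finset.sum_le_univ_sum_of_nonneg fun _ => Nat.zero_le _)
  have hb₂ := hbound W₂
  have hb₃ := hbound W₃
  generalize ∑ e, W₂ e + 1 = K₂ at hb₂
  generalize ∑ e, W₃ e + 1 = K₃ at hb₃
  have hweight : ∀ S : PairSet n m, weight (fun e => (m + 1) * (K₃ * (K₂ * W₁ e + W₂ e) + W₃ e)) S
      = (m + 1) * (K₃ * (K₂ * weight W₁ S + weight W₂ S) + weight W₃ S) := by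
    intro S
    simp only [weight, Finset.mul_sum, Finset.sum_add_distrib, Nat.mul_add]
  have hinj : ∀ S S' : PairSet n m, weight W₃ S = weight W₃ S' → S = S' := by
    intro S S' h
    rcases lexBetter_trichotomy (lt := prec) (fun (e : Fin m × Slot n m) (S : PairSet n m) =>
      ∑ e' ∈ S, if e' = e then 1 else 0) S S' with h' | h' | h'
    · ext e
      have := h' e
      rw [sum_pairScore, sum_pairScore] at this
      split_ifs at this <;> simp_all
    · exact absurd ((h₃ S S').mp h') (not_lt.mpr (le_of_eq h))
    · exact absurd ((h₃ S' S).mp h') (not_lt.mpr (le_of_eq h.symm))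
  have hbest : ∀ (E : Fin m → Set (Fin n)) (S : PairSet n m), S ∈ argmaxOn
      (fun S => K₃ * (K₂ * weight W₁ S + weight W₂ S) + weight W₃ S) (eligibleMatchings E) ↔
      IsBest (fun e => (m + 1) * (K₃ * (K₂ * W₁ e + W₂ e) + W₃ e)) E S := by
    intro E S
    constructor
    · rintro ⟨hS, hmax⟩
      refine ⟨hS, fun S' hS' hne => ?_⟩
      rw [hweight, hweight]
      have hle := hmax S' hS'
      have hlt : K₃ * (K₂ * weight W₁ S' + weight W₂ S') + weight W₃ S'
          < K₃ * (K₂ * weight W₁ S + weight W₂ S) + weight W₃ S := by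
        refine lt_of_le_of_ne hle fun heq => hne (hinj S' S ?_)
        have e1 := congrArg (· % K₃) heq
        simp only [Nat.mul_add_mod, Nat.mod_eq_of_lt (hb₃ _)] at e1
        exact e1
      have := Nat.mul_le_mul_left (m + 1) (Nat.succ_le_of_lt hlt)
      rw [Nat.mul_succ] at this
      omega
    · rintro ⟨hS, hmax⟩
      refine ⟨hS, fun S' hS' => ?_⟩
      by_cases hne : S' = S
      · rw [hne]
      · have := hmax S' hS' hne
        rw [hweight, hweight] at this
        refine le_of_mul_le_mul_left (a := m + 1) ?_ (Nat.succ_pos m)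
        dsimp only
        omega
  refine ⟨fun e => (m + 1) * (K₃ * (K₂ * W₁ e + W₂ e) + W₃ e), fun E => ?_, fun v hv E S => ?_⟩
  · obtain ⟨S, hS, hmax⟩ := (Set.toFinite (eligibleMatchings E)).exists_maximalFor
      (fun S => K₃ * (K₂ * weight W₁ S + weight W₂ S) + weight W₃ S) _
      ⟨∅, empty_mem_eligibleMatchings E⟩
    exact ⟨S, (hbest E S).mp ⟨hS, fun S' hS' => (le_total _ _).elim id fun h => hmax hS' h⟩⟩
  · rw [← hbest, ← argmaxOn_argmaxOn hb₃, ← argmaxOn_argmaxOn hb₂,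
      ← lexOptimal_eq_argmaxOn (f := weight W₁) h₁, ← lexOptimal_eq_argmaxOn (f := weight W₂) h₂,
      ← lexOptimal_eq_argmaxOn (f := weight W₃) h₃, chosenMatchings]
    rw [lexOptimal_congr (lt := roundRobin) fun x S hS S' hS' => slotValue_le_iff hv hS.1 hS'.1 x]
    rw [lexOptimal_congr (lt := fun p q : Fin m => p < q) fun p S hS S' hS' =>
      partWeaklyPrefers_iff I hS.1.1 hS'.1.1 p]
    rw [lexOptimal_congr (lt := prec) fun e S _ S' _ => pairContainment_iff S S' e]

end Choice

/-! ### Prices along the run -/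

section Run

variable {n m : ℕ} {I : MatchingInstance n m} {W : Fin m × Slot n m → ℕ}
  {E : Fin m → Set (Fin n)} {S : PairSet n m}

theorem card_le_of_isMatching (hS : IsMatching S) : S.card ≤ m := by
  have h : Set.InjOn Prod.fst (S : Set (Fin m × Slot n m)) := by
    rintro ⟨p, x⟩ hx ⟨q, y⟩ hy rfl
    rw [hS.1 p x y hx hy]
  rw [← Finset.card_image_of_injOn h]
  exact (Finset.card_le_univ _).trans_eq (Fintype.card_fin m)

/-- Prices can be chosen so that every unmatched participant is strictly priced out of every slot
for which she is eligible: `S` remains optimal when the pairs of unmatched participants gain one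
unit of weight. -/
theorem IsBest.exists_isDual_lt (hn : 0 < n) (h : IsBest W E S) : ∃ u π, IsDual W E S u π ∧
    ∀ p, ¬ PartMatched S p → ∀ x : Slot n m, x.1 ∈ E p → W (p, x) < π x := by
  classical
  let W' : Fin m × Slot n m → ℕ := fun e => W e + if PartMatched S e.1 then 0 else 1
  have hle : ∀ e, W e ≤ W' e := fun e => Nat.le_add_right _ _
  have heq : ∀ p x, (p, x) ∈ S → W' (p, x) = W (p, x) := fun p x hx => by
    have : PartMatched S p := ⟨x, hx⟩
    simp [W', this]
  have hSS : weight W' S = weight W S := Finset.sum_congr rfl fun e he => heq e.1 e.2 he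
  obtain ⟨u, π, hd⟩ := exists_isDual (W := W') hn h.1 fun S' hS' => by
    by_cases hne : S' = S
    · rw [hne]
    · have h1 := h.2 S' hS' hne
      have h2 : weight W' S' ≤ weight W S' + S'.card := by
        rw [weight, weight, Finset.card_eq_sum_ones, ← Finset.sum_add_distrib]
        refine Finset.sum_le_sum fun e _ => ?_
        show W e + _ ≤ W e + 1
        split_ifs <;> omega
      have h3 := card_le_of_isMatching hS'.1
      omega
  refine ⟨u, π, ⟨fun p x hx => (hle _).trans (hd.cover p x hx),
    fun p x hx => (heq p x hx).symm.trans (hd.tight p x hx), hd.part, hd.slot⟩,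
    fun p hp x hx => ?_⟩
  have h1 := hd.cover p x hx
  have h2 := hd.part p hp
  simp only [W', hp, if_false] at h1
  omega

theorem IsBest.mono {F : Fin m → Set (Fin n)} (h : IsBest W E S) (hF : ∀ p, F p ⊆ E p)
    (hS : S ∈ eligibleMatchings F) : IsBest W F S :=
  ⟨hS, fun S' hS' => h.2 S' ⟨hS'.1, fun p x hx => hF p (hS'.2 p x hx)⟩⟩

theorem expandEligibility_of_partMatched {p : Fin m} (hp : PartMatched S p) :
    expandEligibility I E S p = E p := by
  simp [expandEligibility, hp]

theorem subset_expandEligibility (p : Fin m) : E p ⊆ expandEligibility I E S p :=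
  Set.subset_union_left

/-- Participant `p` is eligible for team `i` in the state `(E, S)`, but the slots have turned her
down there: she is unmatched or matched only to a strictly worse team. -/
def Rejected (I : MatchingInstance n m) (E : Fin m → Set (Fin n)) (S : PairSet n m) (p : Fin m)
    (i : Fin n) : Prop :=
  i ∈ E p ∧ ∀ y, (p, y) ∈ S → ¬ (I.partPref p).rel y.1 i

/-- The loop invariant, for a weight `W` maximized by the matchings: eligibility sets are closed
under passing to weakly better teams, matched participants are matched within the indifference
class that they added last, and some optimal prices strictly exclude all rejected pairs. -/
structure Invariant (I : MatchingInstance n m) (W : Fin m × Slot n m → ℕ)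
    (E : Fin m → Set (Fin n)) (S : PairSet n m) : Prop where
  upper : ∀ p i j, i ∈ E p → j ∉ E p → ¬ (I.partPref p).rel j i
  last : ∀ p x, (p, x) ∈ S → ∀ i ∈ E p, (I.partPref p).rel i x.1
  dual : ∃ u π, IsDual W E S u π ∧ ∀ p (x : Slot n m), Rejected I E S p x.1 → W (p, x) < π x

/-- Optimal prices before an expansion and after it have their supremum among the optimal prices
after it: where the old price of a slot was higher, the slot's old partner has not expanded her
eligibility set, and giving her the old utility pays for the higher price. -/
theorem IsDual.sup {S' : PairSet n m} {u u' : Fin m → ℕ} {π π' : Slot n m → ℕ}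
    (hS : S ∈ eligibleMatchings E) (h : IsDual W E S u π)
    (hS' : S' ∈ eligibleMatchings (expandEligibility I E S))
    (h' : IsDual W (expandEligibility I E S) S' u' π') :
    ∃ v, IsDual W (expandEligibility I E S) S' v fun x => max (π x) (π' x) := by
  classical
  let v : Fin m → ℕ := fun p => if ∃ x, (p, x) ∈ S ∧ π' x < π x then u p else u' p
  refine ⟨v, isDual_of_sum_le hS' (fun p x hx => ?_) ?_⟩
  · by_cases hp : ∃ x, (p, x) ∈ S ∧ π' x < π x
    · have hv : v p = u p := if_pos hp
      obtain ⟨y, hy, -⟩ := hp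
      rw [expandEligibility_of_partMatched ⟨y, hy⟩] at hx
      rw [hv]
      exact (h.cover p x hx).trans (Nat.add_le_add_left (le_max_left _ _) _)
    · have hv : v p = u' p := if_neg hp
      rw [hv]
      exact (h'.cover p x hx).trans (Nat.add_le_add_left (le_max_right _ _) _)
  · rw [← h'.sum_eq hS'.1, ← sum_fst_add_sum_compl hS.1 v, ← sum_fst_add_sum_compl hS.1 u',
      ← sum_snd_add_sum_compl hS.1 π', ← sum_snd_add_sum_compl hS.1 fun x => max (π x) (π' x)]
    have h1 : ∑ p ∈ (S.image Prod.fst)ᶜ, v p = ∑ p ∈ (S.image Prod.fst)ᶜ, u' p := by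
      refine Finset.sum_congr rfl fun p hp => if_neg ?_
      rintro ⟨x, hx, -⟩
      exact Finset.mem_compl.mp hp (Finset.mem_image.mpr ⟨(p, x), hx, rfl⟩)
    have h2 : ∑ x ∈ (S.image Prod.snd)ᶜ, max (π x) (π' x) = ∑ x ∈ (S.image Prod.snd)ᶜ, π' x := by
      refine Finset.sum_congr rfl fun x hx => ?_
      rw [h.slot x (by simpa [SlotMatched] using hx), Nat.zero_max]
    have h3 : ∑ e ∈ S, (v e.1 + max (π e.2) (π' e.2)) ≤ ∑ e ∈ S, (u' e.1 + π' e.2) := by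
      refine Finset.sum_le_sum ?_
      rintro ⟨p, x⟩ hx
      by_cases hlt : π' x < π x
      · have hv : v p = u p := if_pos ⟨x, hx, hlt⟩
        have h4 := h.tight p x hx
        have h5 := h'.cover p x (subset_expandEligibility p (hS.2 p x hx))
        simp only [hv, max_eq_left hlt.le]
        omega
      · have hv : v p = u' p := by
          refine if_neg ?_
          rintro ⟨y, hy, hlt'⟩
          rw [hS.1.1 p x y hx hy] at hlt
          exact hlt hlt'
        simp only [hv, max_eq_right (not_lt.mp hlt), le_refl]
    rw [Finset.sum_add_distrib, Finset.sum_add_distrib] at h3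
    omega

theorem Invariant.step (hn : 0 < n) {S' : PairSet n m} (hinv : Invariant I W E S)
    (hS : S ∈ eligibleMatchings E) (hS' : IsBest W (expandEligibility I E S) S') :
    Invariant I W (expandEligibility I E S) S' := by
  obtain ⟨u, π, hd, hlt⟩ := hinv.dual
  obtain ⟨u', π', hd', hlt'⟩ := hS'.exists_isDual_lt hn
  obtain ⟨v, hv⟩ := hd.sup hS hS'.1 hd'
  have hlast : ∀ p x, (p, x) ∈ S' → ∀ i ∈ expandEligibility I E S p,
      (I.partPref p).rel i x.1 := by
    intro p x hx i hi
    have hnot : ¬ Rejected I E S p x.1 := fun hr => by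
      have h1 := hv.tight p x hx
      have h2 := hlt p x hr
      have h3 := le_max_left (π x) (π' x)
      omega
    have hxE := hS'.1.2 p x hx
    by_cases hp : PartMatched S p
    · rw [expandEligibility_of_partMatched hp] at hi hxE
      simp only [Rejected, not_and, not_forall, not_not] at hnot
      obtain ⟨y, hy, hyx⟩ := hnot hxE
      exact (I.partPref p).trans _ _ _ (hinv.last p y hy i hi) hyx
    · have hxE' : x.1 ∉ E p := fun hmem => hnot ⟨hmem, fun y hy => absurd ⟨y, hy⟩ hp⟩
      rcases hi with hi | hi
      · exact ((I.partPref p).total _ _).resolve_right (hinv.upper p i x.1 hi hxE')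
      · exact hi.2.2 _ hxE'
  refine ⟨fun p i j hi hj => ?_, hlast, v, _, hv, fun p x hr => ?_⟩
  · have hj' : j ∉ E p := fun h => hj (subset_expandEligibility p h)
    rcases hi with hi | hi
    · exact hinv.upper p i j hi hj'
    · exact fun hji => hj (Or.inr ⟨hi.1, hj', fun k hk =>
        (I.partPref p).trans _ _ _ hji (hi.2.2 k hk)⟩)
  · by_cases hp : PartMatched S' p
    · obtain ⟨y, hy⟩ := hp
      have hyx := hr.2 y hy
      have hyE := hS'.1.2 p y hy
      have hold : Rejected I E S p x.1 := by
        by_cases hpS : PartMatched S p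
        · have hxE := hr.1
          rw [expandEligibility_of_partMatched hpS] at hxE hyE
          exact ⟨hxE, fun z hz hzx =>
            hyx ((I.partPref p).trans _ _ _ (hinv.last p z hz _ hyE) hzx)⟩
        · refine ⟨?_, fun z hz => absurd ⟨z, hz⟩ hpS⟩
          rcases hr.1 with hxE | hxE
          · exact hxE
          · exact absurd (hlast p y hy y.1 hyE) fun _ => by
              rcases hyE with hyE | hyE
              · exact hyx (((I.partPref p).total _ _).resolve_right
                  (hinv.upper p _ _ hyE hxE.2.1))
              · exact hyx (hyE.2.2 _ hxE.2.1)
      exact (hlt p x hold).trans_le (le_max_left _ _)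
    · exact (hlt' p hp x hr.1).trans_le (le_max_right _ _)

/-! ### Independence of the participants' reports -/

/-- The instance with the same teams' preferences in which all participants are indifferent between
all teams. -/
def MatchingInstance.indifferent (I : MatchingInstance n m) : MatchingInstance n m where
  teamPref := I.teamPref
  partPref _ := ⟨fun _ _ => True, fun _ _ => Or.inl trivial, fun _ _ _ _ _ => trivial⟩

/-- If every participant is indifferent between the teams for which she is eligible, then of her
preferences only the wish to be matched bears on the chosen matching. -/
theorem chosenMatchings_indifferent (v : Slot n m → Fin m → ℝ)
    (prec : Fin m × Slot n m → Fin m × Slot n m → Prop)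
    (hE : ∀ p, ∀ i ∈ E p, ∀ j ∈ E p, (I.partPref p).rel i j) :
    chosenMatchings I v prec E = chosenMatchings I.indifferent v prec E := by
  unfold chosenMatchings
  congr 1
  refine lexOptimal_congr fun p S hS S' hS' => ?_
  refine forall₂_congr fun y hy => exists_congr fun x => and_congr_right fun hx => ?_
  exact ⟨fun _ => trivial, fun _ => hE p _ (hS.1.2 p x hx) _ (hS'.1.2 p y hy)⟩

/-- The eligibility sets after `t` rounds, when `M` chooses the matchings and the loop is continued
beyond its exit. -/
def eligibilityAt (I : MatchingInstance n m) (M : (Fin m → Set (Fin n)) → PairSet n m) :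
    ℕ → Fin m → Set (Fin n)
  | 0 => fun _ => ∅
  | t + 1 => expandEligibility I (eligibilityAt I M t) (M (eligibilityAt I M t))

variable {M : (Fin m → Set (Fin n)) → PairSet n m}

theorem invariant_zero (hS : S ∈ eligibleMatchings (fun _ => ∅)) :
    Invariant I W (fun _ => ∅) S := by
  have hnot : ∀ p x, (p, x) ∉ S := fun p x hx => hS.2 p x hx
  exact ⟨fun p i j hi => hi.elim, fun p x hx => absurd hx (hnot p x), 0, 0,
    ⟨fun p x hx => hx.elim, fun p x hx => absurd hx (hnot p x), fun _ _ => rfl, fun _ _ => rfl⟩,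
    fun p x hr => hr.1.elim⟩

/-- Along the run, the chosen matchings are also the best ones for the weight `W₀` of the instance
with indifferent participants, since they match participants only within the indifference class
added last. -/
theorem invariant_eligibilityAt (hn : 0 < n) {v : Slot n m → Fin m → ℝ}
    {prec : Fin m × Slot n m → Fin m × Slot n m → Prop} {W W₀ : Fin m × Slot n m → ℕ}
    (hW : ∀ E S, S ∈ chosenMatchings I v prec E ↔ IsBest W E S)
    (hW₀ : ∀ E S, S ∈ chosenMatchings I.indifferent v prec E ↔ IsBest W₀ E S)
    (hex : ∀ E, ∃ S, IsBest W₀ E S) (hM : ∀ E, IsBest W E (M E)) (t : ℕ) :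
    Invariant I W₀ (eligibilityAt I M t) (M (eligibilityAt I M t)) ∧
      IsBest W₀ (eligibilityAt I M t) (M (eligibilityAt I M t)) := by
  suffices h : Invariant I W (eligibilityAt I M t) (M (eligibilityAt I M t)) ∧
      Invariant I W₀ (eligibilityAt I M t) (M (eligibilityAt I M t)) ∧
      IsBest W₀ (eligibilityAt I M t) (M (eligibilityAt I M t)) from h.2
  have hsame : ∀ E S, Invariant I W E (M E) → Invariant I W₀ E S → IsBest W₀ E S → S = M E := by
    intro E S h h₀ hS
    let F : Fin m → Set (Fin n) := fun p => {i | i ∈ E p ∧ ∀ j ∈ E p, (I.partPref p).rel j i}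
    have hF : ∀ p, F p ⊆ E p := fun p i hi => hi.1
    have h1 : IsBest W F (M E) := (hM E).mono hF
      ⟨(hM E).1.1, fun p x hx => ⟨(hM E).1.2 p x hx, h.last p x hx⟩⟩
    have h2 : IsBest W₀ F S := hS.mono hF
      ⟨hS.1.1, fun p x hx => ⟨hS.1.2 p x hx, h₀.last p x hx⟩⟩
    rw [← hW₀, ← chosenMatchings_indifferent v prec fun p i hi j hj => hj.2 i hi.1, hW] at h2
    exact h2.unique h1
  induction t with
  | zero =>
    obtain ⟨S, hS⟩ := hex fun _ => ∅
    have h := invariant_zero (I := I) (W := W) (hM fun _ => ∅).1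
    have h₀ := invariant_zero (I := I) (W := W₀) (hM fun _ => ∅).1
    refine ⟨h, h₀, ?_⟩
    have := hsame _ S h (invariant_zero hS.1) hS
    rw [this] at hS
    exact hS
  | succ t ih =>
    obtain ⟨h, h₀, hb⟩ := ih
    obtain ⟨S, hS⟩ := hex (eligibilityAt I M (t + 1))
    have h' : Invariant I W (eligibilityAt I M (t + 1)) (M (eligibilityAt I M (t + 1))) :=
      h.step hn hb.1 (hM _)
    have h₀' : Invariant I W₀ (eligibilityAt I M (t + 1)) S := h₀.step hn hb.1 hS
    have := hsame _ S h' h₀' hS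
    rw [this] at h₀' hS
    exact ⟨h', h₀', hS⟩

/-! ### Termination -/

theorem fullyMatched_of_part (hn : 0 < n) (hS : IsMatching S) (h : ∀ p, PartMatched S p) :
    FullyMatched S := by
  choose f hf using h
  have hinj : Function.Injective f := fun p q hpq =>
    hS.2 p q (f p) (hf p) (hpq ▸ hf q)
  have hbij := (Fintype.bijective_iff_injective_and_card f).mpr
    ⟨hinj, by rw [card_slot hn, Fintype.card_fin]⟩
  exact ⟨fun p => ⟨f p, hf p⟩, fun x => (hbij.2 x).imp fun p (hp : f p = x) => hp ▸ hf p⟩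

theorem fullyMatched_of_slot (hn : 0 < n) (hS : IsMatching S) (h : ∀ x, SlotMatched S x) :
    FullyMatched S := by
  choose f hf using h
  have hinj : Function.Injective f := fun x y hxy =>
    hS.1 (f x) x y (hf x) (hxy ▸ hf y)
  have hbij := (Fintype.bijective_iff_injective_and_card f).mpr
    ⟨hinj, by rw [card_slot hn, Fintype.card_fin]⟩
  exact ⟨fun p => (hbij.2 p).imp fun x (hx : f x = p) => hx ▸ hf x, fun x => ⟨f x, hf x⟩⟩

/-- A best matching leaves no participant unmatched together with a slot of a team for which she is
eligible. -/
theorem IsBest.notMem_of_unmatched (h : IsBest W E S) {p : Fin m} {x : Slot n m}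
    (hp : ¬ PartMatched S p) (hx : ¬ SlotMatched S x) : x.1 ∉ E p := by
  intro hmem
  have hnot : (p, x) ∉ S := fun h => hp ⟨x, h⟩
  have hel : insert (p, x) S ∈ eligibleMatchings E := by
    simp only [eligibleMatchings, IsMatching, Set.mem_ofPred_eq, Finset.mem_insert, Prod.mk.injEq]
    refine ⟨⟨?_, ?_⟩, ?_⟩
    · rintro q y z (⟨rfl, rfl⟩ | hy) (⟨h1, rfl⟩ | hz)
      · rfl
      · exact absurd ⟨z, hz⟩ hp
      · exact absurd ⟨y, h1 ▸ hy⟩ hp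
      · exact h.1.1.1 q y z hy hz
    · rintro q r y (⟨rfl, rfl⟩ | hy) (⟨rfl, h1⟩ | hz)
      · rfl
      · exact absurd ⟨r, hz⟩ hx
      · exact absurd ⟨q, h1 ▸ hy⟩ hx
      · exact h.1.1.2 q r y hy hz
    · rintro q y (⟨rfl, rfl⟩ | hy)
      · exact hmem
      · exact h.1.2 q y hy
  have := h.2 _ hel fun heq => hnot (heq ▸ Finset.mem_insert_self _ _)
  rw [weight, Finset.sum_insert hnot, ← weight] at this
  omega

theorem lt_expandEligibility (hn : 0 < n) (h : IsBest W E S) (hS : ¬ FullyMatched S) :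
    E < expandEligibility I E S := by
  have hp : ∃ p, ¬ PartMatched S p := by
    by_contra! hp
    exact hS (fullyMatched_of_part hn h.1.1 hp)
  have hx : ∃ x, ¬ SlotMatched S x := by
    by_contra! hx
    exact hS (fullyMatched_of_slot hn h.1.1 hx)
  obtain ⟨p, hp⟩ := hp
  obtain ⟨x, hx⟩ := hx
  obtain ⟨i, hi, hmax⟩ := (Set.toFinite (E p)ᶜ).exists_maximalFor (I.partPref p).rank _
    ⟨x.1, h.notMem_of_unmatched hp hx⟩
  refine lt_of_le_of_ne (fun q => subset_expandEligibility q) fun heq => hi ?_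
  have hmem : i ∈ expandEligibility I E S p := Or.inr ⟨hp, hi, fun j hj =>
    ((I.partPref p).rank_le_rank i j).mp ((le_total _ _).elim (hmax hj) id)⟩
  rwa [← heq] at hmem

theorem exists_fullyMatched (hn : 0 < n) (hM : ∀ E, IsBest W E (M E)) :
    ∃ t, FullyMatched (M (eligibilityAt I M t)) := by
  by_contra! h
  have hmono : StrictMono (eligibilityAt I M) :=
    strictMono_nat_of_lt_succ fun t => lt_expandEligibility hn (hM _) (h t)
  exact not_injective_infinite_finite _ hmono.injective

theorem eligibilityAt_eq_of_fullyMatched {s t : ℕ} (hst : s ≤ t)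
    (h : FullyMatched (M (eligibilityAt I M s))) :
    eligibilityAt I M t = eligibilityAt I M s := by
  induction t, hst using Nat.le_induction with
  | base => rfl
  | succ t _ ih =>
    rw [eligibilityAt, ih]
    exact funext fun p => expandEligibility_of_partMatched (h.1 p)

/-- A team enters the eligibility set of a participant only in a round in which she is unmatched and
has been rejected by all teams that she strictly prefers to it. -/
theorem exists_round_of_mem {i : Fin n} {p : Fin m} {s t : ℕ} (hst : s ≤ t)
    (hs : i ∉ eligibilityAt I M s p) (ht : i ∈ eligibilityAt I M t p) :
    ∃ r, s ≤ r ∧ r < t ∧ ¬ PartMatched (M (eligibilityAt I M r)) p ∧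
      ∀ j ∉ eligibilityAt I M r p, (I.partPref p).rel i j := by
  induction t, hst using Nat.le_induction with
  | base => exact absurd ht hs
  | succ t hst ih =>
    by_cases h : i ∈ eligibilityAt I M t p
    · obtain ⟨r, h1, h2, h3⟩ := ih h
      exact ⟨r, h1, h2.trans (Nat.lt_succ_self t), h3⟩
    · rcases ht with ht | ht
      · exact absurd ht h
      · exact ⟨t, hst, Nat.lt_succ_self t, ht.1, ht.2.2⟩

end Run

/-! ### Coalitions -/

section GroupStrategyproofness

variable {n m : ℕ}

/-- The coalition argument. If every member of `X` preferred her team in `S'` to her final team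
under `I`, consider the last round in which a member `p` of `X` is unmatched although the team of
`S' p` is in her eligibility set. The slots that are dearer in this round than at the end of the
other run are matched in this round, and their partners have dearer slots in `S'`. So all partners
in `S'` of dearer slots are matched in this round; but `p` is such a partner. -/
theorem exists_rel_of_misreport {I I' : MatchingInstance n m} {W : Fin m × Slot n m → ℕ}
    {M : (Fin m → Set (Fin n)) → PairSet n m} {T : ℕ} {E' : Fin m → Set (Fin n)}
    {S' : PairSet n m} {X : Set (Fin m)} (hX : X.Nonempty)
    (hI : ∀ p, p ∉ X → I'.partPref p = I.partPref p)
    (hinv : ∀ t, Invariant I W (eligibilityAt I M t) (M (eligibilityAt I M t)))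
    (hM : ∀ E, M E ∈ eligibleMatchings E) (hT : FullyMatched (M (eligibilityAt I M T)))
    (hinv' : Invariant I' W E' S') (hS' : S' ∈ eligibleMatchings E') (hfull' : FullyMatched S') :
    ∃ p ∈ X, ∃ x y, (p, x) ∈ M (eligibilityAt I M T) ∧ (p, y) ∈ S' ∧
      (I.partPref p).rel x.1 y.1 := by
  classical
  by_contra! hcon
  choose a ha using hT.1
  choose b hb using hfull'.1
  replace hcon : ∀ p ∈ X, ¬ (I.partPref p).rel (a p).1 (b p).1 :=
    fun p hp => hcon p hp _ _ (ha p) (hb p)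
  -- the final team enters only after the rejection by the strictly better team of `b p`
  have hround : ∀ p ∈ X, ∀ s ≤ T, (a p).1 ∉ eligibilityAt I M s p → ∃ r, s ≤ r ∧ r < T ∧
      ¬ PartMatched (M (eligibilityAt I M r)) p ∧ (b p).1 ∈ eligibilityAt I M r p := by
    intro p hp s hs hmem
    obtain ⟨r, h1, h2, h3, h4⟩ := exists_round_of_mem hs hmem ((hM _).2 p _ (ha p))
    exact ⟨r, h1, h2, h3, by_contra fun h => hcon p hp (h4 _ h)⟩
  let Q : ℕ → Prop := fun r => r < T ∧ ∃ p ∈ X, ¬ PartMatched (M (eligibilityAt I M r)) p ∧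
    (b p).1 ∈ eligibilityAt I M r p
  obtain ⟨t, ⟨htT, p, hpX, hp, hpb⟩, hlast⟩ : ∃ t, Q t ∧ ∀ r, Q r → r ≤ t := by
    obtain ⟨p, hp⟩ := hX
    obtain ⟨r, -, hr, h1, h2⟩ := hround p hp 0 (Nat.zero_le T) id
    refine ⟨Nat.findGreatest Q T, Nat.findGreatest_spec hr.le ⟨hr, p, hp, h1, h2⟩,
      fun s hs => Nat.le_findGreatest hs.1.le hs⟩
  have hinvt := hinv t
  have hMt := hM (eligibilityAt I M t)
  obtain ⟨u, π, hd, hlt⟩ := hinvt.dual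
  obtain ⟨u', π', hd', hlt'⟩ := hinv'.dual
  let E := eligibilityAt I M t
  let S := M E
  have hdear : ∀ q, Rejected I E S q (b q).1 → π' (b q) < π (b q) := by
    intro q hq
    have h1 := hlt q (b q) hq
    have h2 := hd'.tight q (b q) (hb q)
    omega
  have hstep : ∀ x, π' x < π x → ∃ q, (q, x) ∈ S ∧ π' (b q) < π (b q) := by
    intro x hx
    have hxm : SlotMatched S x := by
      by_contra h
      have := hd.slot x h
      omega
    obtain ⟨q, hq⟩ := hxm
    refine ⟨q, hq, ?_⟩
    have hxE : x.1 ∈ E q := hMt.2 q x hq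
    have htight := hd.tight q x hq
    -- if `q` strictly prefers her slot in `S'` to `x`, she was rejected there before this round
    have hrej : ¬ (I.partPref q).rel x.1 (b q).1 → π' (b q) < π (b q) := fun h =>
      hdear q ⟨by_contra fun hbE => hinvt.upper q x.1 (b q).1 hxE hbE
        (((I.partPref q).total _ _).resolve_left h), fun y hy => by
          rwa [hMt.1.1 q y x hy hq]⟩
    by_cases hqX : q ∈ X
    · refine hrej fun hrel => ?_
      have haE : (a q).1 ∉ E q := fun h =>
        hcon q hqX ((I.partPref q).trans _ _ _ (hinvt.last q x hq _ h) hrel)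
      obtain ⟨r, h1, h2, h3, h4⟩ := hround q hqX t htT.le haE
      obtain rfl : r = t := le_antisymm (hlast r ⟨h2, q, hqX, h3, h4⟩) h1
      exact h3 ⟨x, hq⟩
    · by_cases hrel : (I.partPref q).rel x.1 (b q).1
      · -- `x` is as good as her slot in `S'`, and in the other run she would have been rejected at
        -- `x` if it were strictly better
        have hxE' : x.1 ∈ E' q := by
          by_contra h
          refine hinv'.upper q _ _ (hS'.2 q _ (hb q)) h ?_
          rwa [hI q hqX]
        have hrel' : (I.partPref q).rel (b q).1 x.1 := by
          by_contra h
          have h1 := hlt' q x ⟨hxE', fun y hy => by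
            rwa [hS'.1.1 q y (b q) hy (hb q), hI q hqX]⟩
          omega
        have hbE : (b q).1 ∈ E q := by_contra fun h => hinvt.upper q _ _ hxE h hrel'
        have h1 := hd.cover q (b q) hbE
        have h2 := hd'.tight q (b q) (hb q)
        have h3 := hd'.cover q x hxE'
        omega
      · exact hrej hrel
  have : Nonempty (Fin m) := ⟨p⟩
  choose! f hf hfdear using hstep
  let g : {x // π' x < π x} → {x // π' x < π x} := fun x => ⟨b (f x), hfdear x x.2⟩
  have hg : Function.Injective g := by
    intro x y hxy
    have h1 : b (f x) = b (f y) := congrArg Subtype.val hxy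
    have h2 : f x = f y := hS'.1.2 _ _ (b (f x)) (hb _) (h1 ▸ hb _)
    exact Subtype.ext (hMt.1.1 (f x) _ _ (hf x x.2) (h2 ▸ hf y y.2))
  obtain ⟨x, hx⟩ := Finite.surjective_of_injective hg
    ⟨b p, hdear p ⟨hpb, fun y hy => absurd ⟨y, hy⟩ hp⟩⟩
  have h1 : b (f x) = b p := congrArg Subtype.val hx
  have h2 : f x = p := hS'.1.2 _ _ (b p) (h1 ▸ hb _) (hb p)
  exact hp ⟨x, h2 ▸ hf x x.2⟩

end GroupStrategyproofness

/-! ### The returned allocation -/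

section Returns

variable {n m : ℕ} {I : MatchingInstance n m} {v : Slot n m → Fin m → ℝ}
  {prec : Fin m × Slot n m → Fin m × Slot n m → Prop}
  {M : (Fin m → Set (Fin n)) → PairSet n m}

theorem exists_eq_eligibilityAt_of_reached (hM : ∀ E S, S ∈ chosenMatchings I v prec E ↔ S = M E)
    (hel : ∀ E, M E ∈ eligibleMatchings E) {E : Fin m → Set (Fin n)} {S : PairSet n m}
    (h : Reached I v prec E S) : ∃ t, E = eligibilityAt I M t ∧ S = M E := by
  induction h with
  | init =>
    refine ⟨0, rfl, ?_⟩
    symm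
    rw [Finset.eq_empty_iff_forall_notMem]
    exact fun e he => (hel fun _ => ∅).2 e.1 e.2 he
  | step E S S' _ _ hS' ih =>
    obtain ⟨t, rfl, rfl⟩ := ih
    exact ⟨t + 1, rfl, (hM _ _).mp hS'⟩

theorem reached_eligibilityAt (hM : ∀ E S, S ∈ chosenMatchings I v prec E ↔ S = M E)
    (hel : ∀ E, M E ∈ eligibleMatchings E) (t : ℕ)
    (ht : ∀ s < t, ¬ FullyMatched (M (eligibilityAt I M s))) :
    Reached I v prec (eligibilityAt I M t) (M (eligibilityAt I M t)) := by
  induction t with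
  | zero =>
    have : M (eligibilityAt I M 0) = ∅ := by
      rw [Finset.eq_empty_iff_forall_notMem]
      exact fun e he => (hel fun _ => ∅).2 e.1 e.2 he
    rw [this]
    exact Reached.init
  | succ t ih =>
    exact Reached.step _ _ _ (ih fun s hs => ht s (hs.trans (Nat.lt_succ_self t)))
      (ht t (Nat.lt_succ_self t)) ((hM _ _).mpr rfl)

theorem returns_iff (hM : ∀ E S, S ∈ chosenMatchings I v prec E ↔ S = M E)
    (hel : ∀ E, M E ∈ eligibleMatchings E) {T : ℕ} (hT : FullyMatched (M (eligibilityAt I M T)))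
    {A₀ : Allocation n m} (hA₀ : ∀ p x, (p, x) ∈ M (eligibilityAt I M T) → A₀ p = x.1)
    (A : Allocation n m) : Returns I v prec A ↔ A = A₀ := by
  classical
  constructor
  · rintro ⟨E, S, hreach, hfull, hA⟩
    obtain ⟨t, rfl, rfl⟩ := exists_eq_eligibilityAt_of_reached hM hel hreach
    have heq : eligibilityAt I M t = eligibilityAt I M T := by
      rcases le_total t T with h | h
      · exact (eligibilityAt_eq_of_fullyMatched h hfull).symm
      · exact eligibilityAt_eq_of_fullyMatched h hT
    rw [heq] at hA
    funext p
    obtain ⟨x, hx⟩ := hT.1 p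
    rw [hA p x hx, hA₀ p x hx]
  · rintro rfl
    have hex : ∃ t, FullyMatched (M (eligibilityAt I M t)) := ⟨T, hT⟩
    refine ⟨_, _, reached_eligibilityAt hM hel (Nat.find hex) fun s hs => Nat.find_min hex hs,
      Nat.find_spec hex, ?_⟩
    rwa [← eligibilityAt_eq_of_fullyMatched (Nat.find_min' hex hT) (Nat.find_spec hex)]

end Returns

/-- For all choices of the slots' values and every order `prec` on the pairs (participant, slot),
the algorithm with augmented tie-breaking returns exactly one allocation for each instance, and it
is group-strategyproof for participants. -/
theorem theorem5 {n m : ℕ} (hn : 0 < n)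
    (val : MatchingInstance n m → Slot n m → Fin m → ℝ)
    (hval : ∀ I, ConsistentValues I (val I))
    (prec : Fin m × Slot n m → Fin m × Slot n m → Prop)
    (hprec : IsStrictTotalOrder (Fin m × Slot n m) prec) :
    ∃ alg : MatchingInstance n m → Allocation n m,
      (∀ I A, Returns I (val I) prec A ↔ A = alg I) ∧ GroupStrategyproof alg := by
  choose W hex hW using exists_choiceWeight (n := n) (m := m) prec
  choose M hM using hex
  have hchosen : ∀ I E S, S ∈ chosenMatchings I (val I) prec E ↔ S = M I E := fun I E S =>
    (hW I _ (hval I) E S).trans ⟨fun h => h.unique (hM I E), fun h => h ▸ hM I E⟩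
  have hel : ∀ I E, M I E ∈ eligibleMatchings E := fun I E => (hM I E).1
  choose T hT using fun I => exists_fullyMatched hn (I := I) (hM I)
  choose a ha using fun I => (hT I).1
  have hteam : ∀ I p x, (p, x) ∈ M I (eligibilityAt I (M I) (T I)) → (a I p).1 = x.1 :=
    fun I p x hx => congrArg Sigma.fst ((hel I _).1.1 p _ _ (ha I p) hx)
  have hinv : ∀ I t, Invariant I (W I.indifferent) (eligibilityAt I (M I) t)
      (M I (eligibilityAt I (M I) t)) := fun I t =>
    (invariant_eligibilityAt hn (hW I _ (hval I)) (hW I.indifferent _ (hval I))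
      (fun E => ⟨_, hM I.indifferent E⟩) (hM I) t).1
  refine ⟨fun I p => (a I p).1,
    fun I A => returns_iff (hchosen I) (hel I) (hT I) (hteam I) A, ?_⟩
  intro I I' X hX hteams hparts
  have hindiff : I'.indifferent = I.indifferent := by
    rw [MatchingInstance.indifferent, MatchingInstance.indifferent, hteams]
  obtain ⟨p, hp, x, y, hx, hy, hrel⟩ := exists_rel_of_misreport hX hparts (hinv I) (hel I) (hT I)
    (hindiff ▸ hinv I' (T I')) (hel I' _) (hT I')
  refine ⟨p, hp, ?_⟩
  show (I.partPref p).rel (a I p).1 (a I' p).1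
  rwa [hteam I p x hx, hteam I' p y hy]
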